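/- Consider the untyped call-by-value $\lambda$-calculus with shift and reset: terms (up to $\alpha$-conversion) $t ::= x \mid \lambda x.t \mid t\,t \mid \mathcal{S}k.t \mid \langle t\rangle$; values $v ::= \lambda x.t$; pure contexts $E ::= \Box \mid v\,E \mid E\,t$; evaluation contexts $F ::= \Box \mid v\,F \mid F\,t \mid \langle F\rangle$. Reduction is $F[(\lambda x.t)\,v] \to F[t\{v/x\}]$, $F[\langle E[\mathcal{S}k.t]\rangle] \to F[\langle t\{\lambda x.\langle E[x]\rangle/k\}\rangle]$ ($x$ not free in $E$), and $F[\langle v\rangle] \to F[v]$; $\to^*$ is its reflexive and transitive closure. A term is stuck if it is irreducible and not a value. A program is a term of the form $\langle t\rangle$. For a relation $\mathcal{E}$ on terms, $\widehat{\mathcal{E}}$ is the least relation on terms that contains $\mathcal{E}$ and the pairs $(x,x)$ and is compatible with all term constructors; on evaluation contexts, $\widehat{\mathcal{E}}$ is the least relation that relates $\Box$ to $\Box$ and is compatible with $v\,F$, $F\,t$ and $\langle F\rangle$, where the values and terms in corresponding places are related by $\widehat{\mathcal{E}}$. In the clauses below $\widehat{\mathcal{E}}$ is restricted to closed terms and closed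 contexts. Relaxed semantics. An environment is a relation on closed normal forms that relates values to values and stuck terms to stuck terms. An environmental relation is a set $\mathcal{X}$ of environments $\mathcal{E}$ and of triples $(\mathcal{E},t_0,t_1)$ with $t_0,t_1$ closed. It is an environmental bisimulation if (1) $(\mathcal{E},t_0,t_1)\in\mathcal{X}$ implies: (a) if $t_0\to t_0'$, then $t_1\to^* t_1'$ with $(\mathcal{E},t_0',t_1')\in\mathcal{X}$ for some $t_1'$; (b) if $t_0$ is a value, then $t_1\to^* v_1$ with $\mathcal{E}\cup\{(t_0,v_1)\}\in\mathcal{X}$ for some value $v_1$; (c) if $t_0$ is stuck, then $t_1\to^* t_1'$ with $\mathcal{E}\cup\{(t_0,t_1')\}\in\mathcal{X}$ for some stuck $t_1'$; (d) the converse conditions on $t_1$; (2) $\mathcal{E}\in\mathcal{X}$ implies: (a) if $\lambda x.t_0 \mathrel{\mathcal{E}} \lambda x.t_1$ and $v_0 \mathrel{\widehat{\mathcal{E}}} v_1$ (values), then $(\mathcal{E},t_0\{v_0/x\},t_1\{v_1/x\})\in\mathcal{X}$; (b) if $E_0[\mathcal{S}k.t_0] \mathrel{\mathcal{E}} E_1[\mathcal{S}k.t_1]$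 and $E_0' \mathrel{\widehat{\mathcal{E}}} E_1'$ (pure contexts), then $(\mathcal{E},\langle t_0\{\lambda x.\langle E_0'[E_0[x]]\rangle/k\}\rangle,\langle t_1\{\lambda x.\langle E_1'[E_1[x]]\rangle/k\}\rangle)\in\mathcal{X}$ for a fresh $x$. Let $\simeq$ be the largest environmental bisimulation, and write $t_0\simeq t_1$ for $(\emptyset,t_0,t_1)\in{\simeq}$. Original semantics. Here environments relate only closed values to closed values. An environmental relation $\mathcal{X}$ is an environmental bisimulation for programs if (1) whenever $(\mathcal{E},t_0,t_1)\in\mathcal{X}$, $t_0,t_1$ are not both programs and $E_0 \mathrel{\widehat{\mathcal{E}}} E_1$ (pure contexts), we have $(\mathcal{E},\langle E_0[t_0]\rangle,\langle E_1[t_1]\rangle)\in\mathcal{X}$; (2) whenever $(\mathcal{E},p_0,p_1)\in\mathcal{X}$ with $p_0,p_1$ programs: (a) if $p_0\to p_0'$ with $p_0'$ a program, then $p_1\to^* p_1'$ with $(\mathcal{E},p_0',p_1')\in\mathcal{X}$ for some program $p_1'$; (b) if $p_0\to v_0$ with $v_0$ a value, then $p_1\to^* v_1$ with $\{(v_0,v_1)\}\cup\mathcal{E}\in\mathcal{X}$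 for some value $v_1$; (c) the converse conditions on $p_1$; (3) if $\mathcal{E}\in\mathcal{X}$, $\lambda x.t_0 \mathrel{\mathcal{E}} \lambda x.t_1$ and $v_0 \mathrel{\widehat{\mathcal{E}}} v_1$ (values), then $(\mathcal{E},t_0\{v_0/x\},t_1\{v_1/x\})\in\mathcal{X}$. Let $\simeq^{p}$ be the largest environmental bisimulation for programs, and write $t_0\simeq^{p} t_1$ for $(\emptyset,t_0,t_1)\in{\simeq^{p}}$. Lemma. For all terms $t_0,t_1$, if $t_0\simeq t_1$, then $t_0\simeq^{p} t_1$. Hence, if $\mathcal{X}$ is any environmental bisimulation (for the relaxed semantics) with $(\emptyset,t_0,t_1)\in\mathcal{X}$, then $t_0\simeq^{p} t_1$. -/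

import Mathlib

namespace ShiftReset

/-- Terms of the call-by-value lambda-calculus with shift and reset, up to alpha-conversion:
bound variables are de Bruijn indices. `lam t` and `shift t` bind the index `0` in `t`. -/
inductive Tm : Type
  | var (n : ℕ) : Tm
  | lam (t : Tm) : Tm
  | app (t s : Tm) : Tm
  | shift (t : Tm) : Tm
  | reset (t : Tm) : Tm

namespace Tm

/-- All free variables of the term are smaller than `k`. -/
def ClosedAt : ℕ → Tm → Prop
  | k, var n => n < k
  | k, lam t => ClosedAt (k + 1) t
  | k, app t s => ClosedAt k t ∧ ClosedAt k s
  | k, shift t => ClosedAt (k + 1) t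
  | k, reset t => ClosedAt k t

/-- The term has no free variable. -/
def Closed (t : Tm) : Prop := ClosedAt 0 t

/-- Extension of a renaming under one binder. -/
def upRen (ρ : ℕ → ℕ) : ℕ → ℕ
  | 0 => 0
  | n + 1 => ρ n + 1

/-- Renaming of the free variables. -/
def rename : (ℕ → ℕ) → Tm → Tm
  | ρ, var n => var (ρ n)
  | ρ, lam t => lam (rename (upRen ρ) t)
  | ρ, app t s => app (rename ρ t) (rename ρ s)
  | ρ, shift t => shift (rename (upRen ρ) t)
  | ρ, reset t => reset (rename ρ t)

/-- Extension of a substitution under one binder. -/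
def upSub (σ : ℕ → Tm) : ℕ → Tm
  | 0 => var 0
  | n + 1 => rename Nat.succ (σ n)

/-- Simultaneous capture-avoiding substitution. -/
def subst : (ℕ → Tm) → Tm → Tm
  | σ, var n => σ n
  | σ, lam t => lam (subst (upSub σ) t)
  | σ, app t s => app (subst σ t) (subst σ s)
  | σ, shift t => shift (subst (upSub σ) t)
  | σ, reset t => reset (subst σ t)

/-- The substitution that sends the index `0` to `v` and lowers the other indices. -/
def instSub (v : Tm) : ℕ → Tm
  | 0 => v
  | n + 1 => var n

/-- `t.inst v` is `t{v/x}`, where `x` is the variable of the outermost binder removed from `t`. -/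
def inst (t v : Tm) : Tm := subst (instSub v) t

/-- Values are the lambda-abstractions. -/
def IsValue (t : Tm) : Prop := ∃ b, t = lam b

/-- Programs are the terms with a reset at top level. -/
def IsProgram (t : Tm) : Prop := ∃ s, t = reset s

end Tm

/-- Call-by-value evaluation contexts, represented outside-in. Since values are abstractions,
`vapp b F` stands for the context `v F` with the value `v = lam b`. -/
inductive ECtx : Type
  | hole : ECtx
  | vapp (b : Tm) (F : ECtx) : ECtx
  | appl (F : ECtx) (t : Tm) : ECtx
  | reset (F : ECtx) : ECtx

namespace ECtx

/-- Filling of the hole. -/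
def plug : ECtx → Tm → Tm
  | hole, s => s
  | vapp b F, s => Tm.app (Tm.lam b) (F.plug s)
  | appl F t, s => Tm.app (F.plug s) t
  | reset F, s => Tm.reset (F.plug s)

/-- Pure contexts are the evaluation contexts without reset. -/
def IsPure : ECtx → Prop
  | hole => True
  | vapp _ F => F.IsPure
  | appl F _ => F.IsPure
  | reset _ => False

/-- The context has no free variable. -/
def Closed : ECtx → Prop
  | hole => True
  | vapp b F => (Tm.lam b).Closed ∧ F.Closed
  | appl F t => F.Closed ∧ t.Closed
  | reset F => F.Closed

/-- Shifts the free variables of the context by one, so that the index `0` becomes fresh. -/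
def lift : ECtx → ECtx
  | hole => hole
  | vapp b F => vapp (b.rename (Tm.upRen Nat.succ)) F.lift
  | appl F t => appl F.lift (t.rename Nat.succ)
  | reset F => reset F.lift

end ECtx

/-- One-step reduction. -/
inductive Red : Tm → Tm → Prop
  | beta (F : ECtx) (t v : Tm) (hv : v.IsValue) :
      Red (F.plug (Tm.app (Tm.lam t) v)) (F.plug (t.inst v))
  | shift (F E : ECtx) (t : Tm) (hE : E.IsPure) :
      Red (F.plug (Tm.reset (E.plug (Tm.shift t))))
        (F.plug (Tm.reset (t.inst (Tm.lam (Tm.reset (E.lift.plug (Tm.var 0)))))))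
  | reset (F : ECtx) (v : Tm) (hv : v.IsValue) :
      Red (F.plug (Tm.reset v)) (F.plug v)

/-- Reflexive and transitive closure of reduction. -/
def Reds : Tm → Tm → Prop := Relation.ReflTransGen Red

/-- A stuck term is an irreducible term that is not a value. -/
def Stuck (t : Tm) : Prop := ¬ t.IsValue ∧ ∀ t', ¬ Red t t'

/-- Term-generating closure of a relation, on possibly open terms. -/
inductive TmCl (r : Set (Tm × Tm)) : Tm → Tm → Prop
  | base {t t' : Tm} (h : (t, t') ∈ r) : TmCl r t t'
  | var (n : ℕ) : TmCl r (Tm.var n) (Tm.var n)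
  | lam {t t' : Tm} (h : TmCl r t t') : TmCl r (Tm.lam t) (Tm.lam t')
  | app {t t' s s' : Tm} (h : TmCl r t t') (h' : TmCl r s s') :
      TmCl r (Tm.app t s) (Tm.app t' s')
  | shift {t t' : Tm} (h : TmCl r t t') : TmCl r (Tm.shift t) (Tm.shift t')
  | reset {t t' : Tm} (h : TmCl r t t') : TmCl r (Tm.reset t) (Tm.reset t')

/-- Context-generating closure of a relation, on possibly open evaluation contexts. -/
inductive CtxCl (r : Set (Tm × Tm)) : ECtx → ECtx → Prop
  | hole : CtxCl r ECtx.hole ECtx.hole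
  | vapp {b b' : Tm} {F F' : ECtx} (hF : CtxCl r F F') (hv : TmCl r (Tm.lam b) (Tm.lam b')) :
      CtxCl r (ECtx.vapp b F) (ECtx.vapp b' F')
  | appl {t t' : Tm} {F F' : ECtx} (hF : CtxCl r F F') (ht : TmCl r t t') :
      CtxCl r (ECtx.appl F t) (ECtx.appl F' t')
  | reset {F F' : ECtx} (hF : CtxCl r F F') : CtxCl r (ECtx.reset F) (ECtx.reset F')

/-- Closed values related by the term-generating closure. -/
def ValCl (r : Set (Tm × Tm)) (v₀ v₁ : Tm) : Prop :=
  TmCl r v₀ v₁ ∧ v₀.IsValue ∧ v₁.IsValue ∧ v₀.Closed ∧ v₁.Closed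

/-- Closed pure contexts related by the context-generating closure. -/
def PureCl (r : Set (Tm × Tm)) (E₀ E₁ : ECtx) : Prop :=
  CtxCl r E₀ E₁ ∧ E₀.IsPure ∧ E₁.IsPure ∧ E₀.Closed ∧ E₁.Closed

/-- A set of binary relations `E` on terms, together with a set of triples `(E, t₀, t₁)`. -/
structure Rel where
  /-- the relations that belong to the set -/
  envs : Set (Set (Tm × Tm))
  /-- the triples that belong to the set -/
  triples : Set (Set (Tm × Tm) × Tm × Tm)

/-- Inclusion. -/
def Rel.Sub (R S : Rel) : Prop := R.envs ⊆ S.envs ∧ R.triples ⊆ S.triples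

/-! ### The relaxed semantics -/

/-- Environments relate closed values with closed values and closed stuck terms with closed stuck
terms. -/
def IsEnv (E : Set (Tm × Tm)) : Prop :=
  ∀ t₀ t₁, (t₀, t₁) ∈ E →
    t₀.Closed ∧ t₁.Closed ∧ ((t₀.IsValue ∧ t₁.IsValue) ∨ (Stuck t₀ ∧ Stuck t₁))

/-- Environmental bisimulations (for the relaxed semantics). -/
structure IsEnvBisim (R : Rel) : Prop where
  env_wf : ∀ E ∈ R.envs, IsEnv E
  triple_wf : ∀ E t₀ t₁, (E, t₀, t₁) ∈ R.triples → IsEnv E ∧ t₀.Closed ∧ t₁.Closed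
  red_left : ∀ E t₀ t₁, (E, t₀, t₁) ∈ R.triples → ∀ t₀', Red t₀ t₀' →
    ∃ t₁', Reds t₁ t₁' ∧ (E, t₀', t₁') ∈ R.triples
  val_left : ∀ E t₀ t₁, (E, t₀, t₁) ∈ R.triples → t₀.IsValue →
    ∃ v₁, Reds t₁ v₁ ∧ v₁.IsValue ∧ E ∪ {(t₀, v₁)} ∈ R.envs
  stuck_left : ∀ E t₀ t₁, (E, t₀, t₁) ∈ R.triples → Stuck t₀ →
    ∃ t₁', Reds t₁ t₁' ∧ Stuck t₁' ∧ E ∪ {(t₀, t₁')} ∈ R.envs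
  red_right : ∀ E t₀ t₁, (E, t₀, t₁) ∈ R.triples → ∀ t₁', Red t₁ t₁' →
    ∃ t₀', Reds t₀ t₀' ∧ (E, t₀', t₁') ∈ R.triples
  val_right : ∀ E t₀ t₁, (E, t₀, t₁) ∈ R.triples → t₁.IsValue →
    ∃ v₀, Reds t₀ v₀ ∧ v₀.IsValue ∧ E ∪ {(v₀, t₁)} ∈ R.envs
  stuck_right : ∀ E t₀ t₁, (E, t₀, t₁) ∈ R.triples → Stuck t₁ →
    ∃ t₀', Reds t₀ t₀' ∧ Stuck t₀' ∧ E ∪ {(t₀', t₁)} ∈ R.envs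
  env_val : ∀ E ∈ R.envs, ∀ t₀ t₁, (Tm.lam t₀, Tm.lam t₁) ∈ E → ∀ v₀ v₁, ValCl E v₀ v₁ →
    (E, t₀.inst v₀, t₁.inst v₁) ∈ R.triples
  env_stuck : ∀ E ∈ R.envs, ∀ (C₀ C₁ : ECtx) (t₀ t₁ : Tm), C₀.IsPure → C₁.IsPure →
    (C₀.plug (Tm.shift t₀), C₁.plug (Tm.shift t₁)) ∈ E → ∀ D₀ D₁, PureCl E D₀ D₁ →
    (E,
      Tm.reset (t₀.inst (Tm.lam (Tm.reset (D₀.lift.plug (C₀.lift.plug (Tm.var 0)))))),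
      Tm.reset (t₁.inst (Tm.lam (Tm.reset (D₁.lift.plug (C₁.lift.plug (Tm.var 0))))))) ∈
        R.triples

/-- Environmental bisimilarity: the union of all environmental bisimulations. -/
def bisim : Rel where
  envs := {E | ∃ R, IsEnvBisim R ∧ E ∈ R.envs}
  triples := {p | ∃ R, IsEnvBisim R ∧ p ∈ R.triples}

/-- Two terms are bisimilar with the empty environment. -/
def EmpBisim (t₀ t₁ : Tm) : Prop := (∅, t₀, t₁) ∈ bisim.triples

/-! ### The original semantics -/

/-- For the original semantics, environments relate closed values with closed values. -/
def IsValEnv (E : Set (Tm × Tm)) : Prop :=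
  ∀ t₀ t₁, (t₀, t₁) ∈ E → t₀.Closed ∧ t₁.Closed ∧ t₀.IsValue ∧ t₁.IsValue

/-- Environmental bisimulations for programs. -/
structure IsEnvBisimP (R : Rel) : Prop where
  env_wf : ∀ E ∈ R.envs, IsValEnv E
  triple_wf : ∀ E t₀ t₁, (E, t₀, t₁) ∈ R.triples → IsValEnv E ∧ t₀.Closed ∧ t₁.Closed
  ctx : ∀ E t₀ t₁, (E, t₀, t₁) ∈ R.triples → ¬ (t₀.IsProgram ∧ t₁.IsProgram) →
    ∀ C₀ C₁, PureCl E C₀ C₁ → (E, Tm.reset (C₀.plug t₀), Tm.reset (C₁.plug t₁)) ∈ R.triples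
  red_left : ∀ E p₀ p₁, (E, p₀, p₁) ∈ R.triples → p₀.IsProgram → p₁.IsProgram →
    ∀ p₀', Red p₀ p₀' → p₀'.IsProgram →
    ∃ p₁', Reds p₁ p₁' ∧ p₁'.IsProgram ∧ (E, p₀', p₁') ∈ R.triples
  val_left : ∀ E p₀ p₁, (E, p₀, p₁) ∈ R.triples → p₀.IsProgram → p₁.IsProgram →
    ∀ v₀, Red p₀ v₀ → v₀.IsValue →
    ∃ v₁, Reds p₁ v₁ ∧ v₁.IsValue ∧ {(v₀, v₁)} ∪ E ∈ R.envs
  red_right : ∀ E p₀ p₁, (E, p₀, p₁) ∈ R.triples → p₀.IsProgram → p₁.IsProgram →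
    ∀ p₁', Red p₁ p₁' → p₁'.IsProgram →
    ∃ p₀', Reds p₀ p₀' ∧ p₀'.IsProgram ∧ (E, p₀', p₁') ∈ R.triples
  val_right : ∀ E p₀ p₁, (E, p₀, p₁) ∈ R.triples → p₀.IsProgram → p₁.IsProgram →
    ∀ v₁, Red p₁ v₁ → v₁.IsValue →
    ∃ v₀, Reds p₀ v₀ ∧ v₀.IsValue ∧ {(v₀, v₁)} ∪ E ∈ R.envs
  env_val : ∀ E ∈ R.envs, ∀ t₀ t₁, (Tm.lam t₀, Tm.lam t₁) ∈ E → ∀ v₀ v₁, ValCl E v₀ v₁ →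
    (E, t₀.inst v₀, t₁.inst v₁) ∈ R.triples

/-- Environmental bisimilarity for programs: the union of all environmental bisimulations for
programs. -/
def bisimP : Rel where
  envs := {E | ∃ R, IsEnvBisimP R ∧ E ∈ R.envs}
  triples := {p | ∃ R, IsEnvBisimP R ∧ p ∈ R.triples}

/-- Two terms are bisimilar for programs with the empty environment. -/
def EmpBisimP (t₀ t₁ : Tm) : Prop := (∅, t₀, t₁) ∈ bisimP.triples

/-! ### The two bisimilarities are the largest bisimulations -/

/-- Every environmental bisimulation is included in environmental bisimilarity. -/
theorem IsEnvBisim.sub_bisim {R : Rel} (hR : IsEnvBisim R) : R.Sub bisim :=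
  ⟨fun _ h => ⟨R, hR, h⟩, fun _ h => ⟨R, hR, h⟩⟩

/-- Environmental bisimilarity is an environmental bisimulation. -/
theorem bisim_isEnvBisim : IsEnvBisim bisim where
  env_wf := fun E ⟨_, hR, h⟩ => hR.env_wf E h
  triple_wf := fun E t₀ t₁ ⟨_, hR, h⟩ => hR.triple_wf E t₀ t₁ h
  red_left := fun E t₀ t₁ ⟨R, hR, h⟩ t₀' hr =>
    let ⟨s, h1, h2⟩ := hR.red_left E t₀ t₁ h t₀' hr
    ⟨s, h1, R, hR, h2⟩
  val_left := fun E t₀ t₁ ⟨R, hR, h⟩ hr =>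
    let ⟨s, h1, h2, h3⟩ := hR.val_left E t₀ t₁ h hr
    ⟨s, h1, h2, R, hR, h3⟩
  stuck_left := fun E t₀ t₁ ⟨R, hR, h⟩ hr =>
    let ⟨s, h1, h2, h3⟩ := hR.stuck_left E t₀ t₁ h hr
    ⟨s, h1, h2, R, hR, h3⟩
  red_right := fun E t₀ t₁ ⟨R, hR, h⟩ t₁' hr =>
    let ⟨s, h1, h2⟩ := hR.red_right E t₀ t₁ h t₁' hr
    ⟨s, h1, R, hR, h2⟩
  val_right := fun E t₀ t₁ ⟨R, hR, h⟩ hr =>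
    let ⟨s, h1, h2, h3⟩ := hR.val_right E t₀ t₁ h hr
    ⟨s, h1, h2, R, hR, h3⟩
  stuck_right := fun E t₀ t₁ ⟨R, hR, h⟩ hr =>
    let ⟨s, h1, h2, h3⟩ := hR.stuck_right E t₀ t₁ h hr
    ⟨s, h1, h2, R, hR, h3⟩
  env_val := fun E ⟨R, hR, h⟩ t₀ t₁ ht v₀ v₁ hv =>
    ⟨R, hR, hR.env_val E h t₀ t₁ ht v₀ v₁ hv⟩
  env_stuck := fun E ⟨R, hR, h⟩ C₀ C₁ t₀ t₁ h₀ h₁ ht D₀ D₁ hD =>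
    ⟨R, hR, hR.env_stuck E h C₀ C₁ t₀ t₁ h₀ h₁ ht D₀ D₁ hD⟩

/-- Every environmental bisimulation for programs is included in environmental bisimilarity for
programs. -/
theorem IsEnvBisimP.sub_bisimP {R : Rel} (hR : IsEnvBisimP R) : R.Sub bisimP :=
  ⟨fun _ h => ⟨R, hR, h⟩, fun _ h => ⟨R, hR, h⟩⟩

/-- Environmental bisimilarity for programs is an environmental bisimulation for programs. -/
theorem bisimP_isEnvBisimP : IsEnvBisimP bisimP where
  env_wf := fun E ⟨_, hR, h⟩ => hR.env_wf E h
  triple_wf := fun E t₀ t₁ ⟨_, hR, h⟩ => hR.triple_wf E t₀ t₁ h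
  ctx := fun E t₀ t₁ ⟨R, hR, h⟩ hn C₀ C₁ hC => ⟨R, hR, hR.ctx E t₀ t₁ h hn C₀ C₁ hC⟩
  red_left := fun E p₀ p₁ ⟨R, hR, h⟩ h₀ h₁ p₀' hr hp =>
    let ⟨s, h1, h2, h3⟩ := hR.red_left E p₀ p₁ h h₀ h₁ p₀' hr hp
    ⟨s, h1, h2, R, hR, h3⟩
  val_left := fun E p₀ p₁ ⟨R, hR, h⟩ h₀ h₁ v hr hv =>
    let ⟨s, h1, h2, h3⟩ := hR.val_left E p₀ p₁ h h₀ h₁ v hr hv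
    ⟨s, h1, h2, R, hR, h3⟩
  red_right := fun E p₀ p₁ ⟨R, hR, h⟩ h₀ h₁ p₁' hr hp =>
    let ⟨s, h1, h2, h3⟩ := hR.red_right E p₀ p₁ h h₀ h₁ p₁' hr hp
    ⟨s, h1, h2, R, hR, h3⟩
  val_right := fun E p₀ p₁ ⟨R, hR, h⟩ h₀ h₁ v hr hv =>
    let ⟨s, h1, h2, h3⟩ := hR.val_right E p₀ p₁ h h₀ h₁ v hr hv
    ⟨s, h1, h2, R, hR, h3⟩
  env_val := fun E ⟨R, hR, h⟩ t₀ t₁ ht v₀ v₁ hv =>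
    ⟨R, hR, hR.env_val E h t₀ t₁ ht v₀ v₁ hv⟩

end ShiftReset

/-! From a relaxed bisimulation `R` a bisimulation for programs is built, by adding to `R` the
contexts over which the original semantics quantifies and by hiding the stuck terms, which its
environments cannot contain. Two terms are `Matched` over a value environment `V` if they have the
form `F₀[t₀]`, `F₁[t₁]` with `(E, t₀, t₁)` in `R` and contexts related by the closure of `E`, or if
they are themselves related by the closure of an environment `E` of `R`. In both cases the closure
of `E` contains `V`, but `E` may also hold stuck pairs.

The crux is `red_of_matched`: a step on the left of a matched pair is answered on the right by steps
leading to a matched pair. If `t₀` reduces, `red_left` and determinism suffice. If `t₀` is normal,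
`t₁` evaluates to a normal form `s₁`, and adding `(t₀, s₁)` to `E` turns the first kind of matching
into the second. For the second kind (`red_of_tmCl`), the redex either consists of constructors
shared by both sides, and compatibility with substitution suffices, or it consumes a pair of the
environment: application of a value is covered by `env_val`, capture by a stuck term by `env_stuck`.
The clause on stuck terms thus does the work of the original clause on contexts.

Finally `programRel` also admits terms that only reduce to matched ones, and the clauses on the
right follow by exchanging the two sides. -/

namespace ShiftReset

namespace Tm

/-! ### Closed terms, renaming and substitution -/

theorem ClosedAt.rename : ∀ {t : Tm} {k m : ℕ} {ρ : ℕ → ℕ}, t.ClosedAt k →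
    (∀ n < k, ρ n < m) → (t.rename ρ).ClosedAt m
  | var n, _, _, _, h, hρ => hρ n h
  | lam t, k, m, ρ, h, hρ | shift t, k, m, ρ, h, hρ => by
    refine ClosedAt.rename (t := t) h ?_
    rintro (_ | n) hn
    · exact Nat.succ_pos m
    · exact Nat.succ_lt_succ (hρ n (Nat.lt_of_succ_lt_succ hn))
  | app _ _, _, _, _, h, hρ => ⟨h.1.rename hρ, h.2.rename hρ⟩
  | reset t, _, _, _, h, hρ => ClosedAt.rename (t := t) h hρ

theorem ClosedAt.subst : ∀ {t : Tm} {k m : ℕ} {σ : ℕ → Tm}, t.ClosedAt k →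
    (∀ n < k, (σ n).ClosedAt m) → (t.subst σ).ClosedAt m
  | var n, _, _, _, h, hσ => hσ n h
  | lam t, k, m, σ, h, hσ | shift t, k, m, σ, h, hσ => by
    refine ClosedAt.subst (t := t) h ?_
    rintro (_ | n) hn
    · exact Nat.succ_pos m
    · exact (hσ n (Nat.lt_of_succ_lt_succ hn)).rename fun _ h => Nat.succ_lt_succ h
  | app _ _, _, _, _, h, hσ => ⟨h.1.subst hσ, h.2.subst hσ⟩
  | reset t, _, _, _, h, hσ => ClosedAt.subst (t := t) h hσ

theorem ClosedAt.rename_eq : ∀ {t : Tm} {k : ℕ} {ρ : ℕ → ℕ}, t.ClosedAt k →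
    (∀ n < k, ρ n = n) → t.rename ρ = t
  | var n, _, _, h, hρ => congrArg var (hρ n h)
  | lam t, k, ρ, h, hρ => by
    refine congrArg lam (ClosedAt.rename_eq (t := t) h ?_)
    rintro (_ | n) hn
    · rfl
    · exact congrArg Nat.succ (hρ n (Nat.lt_of_succ_lt_succ hn))
  | shift t, k, ρ, h, hρ => by
    refine congrArg shift (ClosedAt.rename_eq (t := t) h ?_)
    rintro (_ | n) hn
    · rfl
    · exact congrArg Nat.succ (hρ n (Nat.lt_of_succ_lt_succ hn))
  | app _ _, _, _, h, hρ => congrArg₂ app (h.1.rename_eq hρ) (h.2.rename_eq hρ)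
  | reset t, _, _, h, hρ => congrArg reset (ClosedAt.rename_eq (t := t) h hρ)

theorem ClosedAt.subst_eq : ∀ {t : Tm} {k : ℕ} {σ : ℕ → Tm}, t.ClosedAt k →
    (∀ n < k, σ n = var n) → t.subst σ = t
  | var n, _, _, h, hσ => hσ n h
  | lam t, k, σ, h, hσ => by
    refine congrArg lam (ClosedAt.subst_eq (t := t) h ?_)
    rintro (_ | n) hn
    · rfl
    · simp [upSub, hσ n (Nat.lt_of_succ_lt_succ hn), Tm.rename]
  | shift t, k, σ, h, hσ => by
    refine congrArg shift (ClosedAt.subst_eq (t := t) h ?_)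
    rintro (_ | n) hn
    · rfl
    · simp [upSub, hσ n (Nat.lt_of_succ_lt_succ hn), Tm.rename]
  | app _ _, _, _, h, hσ => congrArg₂ app (h.1.subst_eq hσ) (h.2.subst_eq hσ)
  | reset t, _, _, h, hσ => congrArg reset (ClosedAt.subst_eq (t := t) h hσ)

theorem Closed.rename_eq {t : Tm} (h : t.Closed) (ρ : ℕ → ℕ) : t.rename ρ = t :=
  ClosedAt.rename_eq h fun _ h => absurd h (Nat.not_lt_zero _)

theorem Closed.subst_eq {t : Tm} (h : t.Closed) (σ : ℕ → Tm) : t.subst σ = t :=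
  ClosedAt.subst_eq h fun _ h => absurd h (Nat.not_lt_zero _)

theorem ClosedAt.inst {t v : Tm} (ht : t.ClosedAt 1) (hv : v.Closed) : (t.inst v).Closed := by
  refine ht.subst fun n hn => ?_
  obtain rfl : n = 0 := by omega
  exact hv

end Tm

namespace ECtx

/-! ### Evaluation contexts -/

/-- Composition: `(F.comp G).plug t` is `F.plug (G.plug t)`. -/
def comp : ECtx → ECtx → ECtx
  | hole, G => G
  | vapp b F, G => vapp b (F.comp G)
  | appl F t, G => appl (F.comp G) t
  | reset F, G => reset (F.comp G)

theorem comp_plug (F G : ECtx) (t : Tm) : (F.comp G).plug t = F.plug (G.plug t) := by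
  induction F <;> simp_all [comp, plug]

theorem comp_lift (F G : ECtx) : (F.comp G).lift = F.lift.comp G.lift := by
  induction F <;> simp_all [comp, lift]

theorem comp_isPure {F G : ECtx} : (F.comp G).IsPure ↔ F.IsPure ∧ G.IsPure := by
  induction F <;> simp_all [comp, IsPure]

theorem plug_closed {F : ECtx} {t : Tm} : (F.plug t).Closed ↔ F.Closed ∧ t.Closed := by
  induction F <;> simp_all [plug, Closed, Tm.Closed, Tm.ClosedAt] <;> tauto

theorem Closed.lift_plug {F : ECtx} (h : F.Closed) : (F.lift.plug (Tm.var 0)).ClosedAt 1 := by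
  have hs {t : Tm} (ht : t.Closed) : (t.rename Nat.succ).ClosedAt 1 :=
    Tm.ClosedAt.rename ht fun _ h => absurd h (Nat.not_lt_zero _)
  induction F with
  | hole => exact Nat.zero_lt_one
  -- `vapp` stores only the body of its value, so closedness concerns `b.lam`, whose renaming
  -- produces the `upRen` in `lift`.
  | vapp b F ih => exact ⟨hs (t := b.lam) h.1, ih h.2⟩
  | appl F t ih => exact ⟨ih h.1, hs h.2⟩
  | reset F ih => exact ih h

theorem plug_shift_not_isValue {F : ECtx} {t : Tm} : ¬ (F.plug (Tm.shift t)).IsValue := by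
  rintro ⟨b, h⟩
  cases F <;> simp [plug] at h

/-- The only possible ambiguity is whether to descend to the left or to the right of an application.
Descending to the right requires an abstraction on the left, and an abstraction is never a filled
`F[Sk.t]`. -/
theorem IsPure.plug_shift_inj {F G : ECtx} {t s : Tm} (hF : F.IsPure) (hG : G.IsPure)
    (h : F.plug (Tm.shift t) = G.plug (Tm.shift s)) : F = G ∧ t = s := by
  have aux {b u : Tm} {H : ECtx} (h : Tm.lam b = H.plug (Tm.shift u)) : False :=
    plug_shift_not_isValue ⟨b, h.symm⟩
  induction F generalizing G with
  | hole => cases G <;> simp_all [plug]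
  | vapp b F ih =>
    cases G with
    | vapp c G =>
      simp only [plug, Tm.app.injEq, Tm.lam.injEq] at h
      obtain ⟨hFG, hts⟩ := ih (G := G) hF hG h.2
      rw [h.1, hFG]
      exact ⟨rfl, hts⟩
    | appl G u =>
      simp only [plug, Tm.app.injEq] at h
      exact (aux h.1).elim
    | _ => simp [plug] at h
  | appl F u ih =>
    cases G with
    | vapp c G =>
      simp only [plug, Tm.app.injEq] at h
      exact (aux h.1.symm).elim
    | appl G u =>
      simp only [plug, Tm.app.injEq] at h
      obtain ⟨hFG, hts⟩ := ih (G := G) hF hG h.1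
      rw [h.2, hFG]
      exact ⟨rfl, hts⟩
    | _ => simp [plug] at h
  | reset F => exact hF.elim

end ECtx

/-! ### Reduction -/

theorem Red.plug {t t' : Tm} (F : ECtx) (h : Red t t') : Red (F.plug t) (F.plug t') := by
  cases h with
  | beta G t v hv => simpa only [ECtx.comp_plug] using Red.beta (F.comp G) t v hv
  | shift G E t hE => simpa only [ECtx.comp_plug] using Red.shift (F.comp G) E t hE
  | reset G v hv => simpa only [ECtx.comp_plug] using Red.reset (F.comp G) v hv

theorem Reds.plug {t t' : Tm} (F : ECtx) (h : Reds t t') : Reds (F.plug t) (F.plug t') :=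
  Relation.ReflTransGen.lift F.plug (fun _ _ => Red.plug F) _ _ h

/-- The term `⟨t{λx.⟨E[x]⟩/k}⟩`, to which `⟨E[Sk.t]⟩` reduces. -/
def capture (E : ECtx) (t : Tm) : Tm :=
  Tm.reset (t.inst (Tm.lam (Tm.reset (E.lift.plug (Tm.var 0)))))

theorem Red.var_inv {n : ℕ} {u : Tm} (h : Red (Tm.var n) u) : False := by
  generalize ht : Tm.var n = t at h
  cases h with
  | _ F => cases F <;> simp [ECtx.plug] at ht

theorem Red.lam_inv {t u : Tm} (h : Red (Tm.lam t) u) : False := by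
  generalize ht : Tm.lam t = t at h
  cases h with
  | reset F v hv => cases F <;> simp [ECtx.plug] at ht
  | _ F => cases F <;> simp [ECtx.plug] at ht

theorem Red.shift_inv {t u : Tm} (h : Red (Tm.shift t) u) : False := by
  generalize ht : Tm.shift t = t at h
  cases h with
  | _ F => cases F <;> simp [ECtx.plug] at ht

/-- Together with `Red.reset_inv`, this trades the evaluation context in the definition of `Red` for
immediate subterms, so that later proofs can proceed by induction on terms. -/
theorem Red.app_inv {t s u : Tm} (h : Red (Tm.app t s) u) :
    (∃ t', Red t t' ∧ u = Tm.app t' s) ∨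
    (∃ b s', t = Tm.lam b ∧ Red s s' ∧ u = Tm.app (Tm.lam b) s') ∨
    (∃ b, t = Tm.lam b ∧ s.IsValue ∧ u = b.inst s) := by
  generalize hr : Tm.app t s = r at h
  -- A redex under a nonempty context lies inside one immediate subterm, whichever rule contracts
  -- it.
  have key (F : ECtx) {a a' : Tm} (ha : Red a a')
      (hr : Tm.app t s = F.plug a) (hF : F ≠ .hole) :
      (∃ t', Red t t' ∧ F.plug a' = Tm.app t' s) ∨
      (∃ b s', t = Tm.lam b ∧ Red s s' ∧ F.plug a' = Tm.app (Tm.lam b) s') := by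
    cases F with
    | hole => exact absurd rfl hF
    | vapp b F =>
      obtain ⟨rfl, rfl⟩ := Tm.app.inj hr
      exact .inr ⟨b, _, rfl, ha.plug F, rfl⟩
    | appl F c =>
      obtain ⟨rfl, rfl⟩ := Tm.app.inj hr
      exact .inl ⟨_, ha.plug F, rfl⟩
    | reset F => simp [ECtx.plug] at hr
  cases h with
  | beta F c v hv =>
    by_cases hF : F = .hole
    · subst hF
      obtain ⟨rfl, rfl⟩ := Tm.app.inj hr
      exact .inr (.inr ⟨c, rfl, hv, rfl⟩)
    · exact (key F (Red.beta .hole c v hv) hr hF).imp_right .inl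
  | shift F E c hE =>
    refine (key F (Red.shift .hole E c hE) hr ?_).imp_right .inl
    rintro rfl
    simp [ECtx.plug] at hr
  | reset F v hv =>
    refine (key F (Red.reset .hole v hv) hr ?_).imp_right .inl
    rintro rfl
    simp [ECtx.plug] at hr

theorem Red.reset_inv {t u : Tm} (h : Red (Tm.reset t) u) :
    (∃ t', Red t t' ∧ u = Tm.reset t') ∨ (t.IsValue ∧ u = t) ∨
    (∃ (E : ECtx) (b : Tm), E.IsPure ∧ t = E.plug (Tm.shift b) ∧ u = capture E b) := by
  generalize hr : Tm.reset t = r at h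
  have key (F : ECtx) {a a' : Tm} (ha : Red a a')
      (hr : Tm.reset t = F.plug a) (hF : F ≠ .hole) :
      (∃ t', Red t t' ∧ F.plug a' = Tm.reset t') := by
    cases F with
    | hole => exact absurd rfl hF
    | reset F =>
      obtain rfl := Tm.reset.inj hr
      exact ⟨_, ha.plug F, rfl⟩
    | _ => simp [ECtx.plug] at hr
  cases h with
  | beta F c v hv =>
    refine .inl (key F (Red.beta .hole c v hv) hr ?_)
    rintro rfl
    simp [ECtx.plug] at hr
  | shift F E c hE =>
    by_cases hF : F = .hole
    · subst hF
      obtain rfl := Tm.reset.inj hr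
      exact .inr (.inr ⟨E, c, hE, rfl, rfl⟩)
    · exact .inl (key F (Red.shift .hole E c hE) hr hF)
  | reset F v hv =>
    by_cases hF : F = .hole
    · subst hF
      obtain rfl := Tm.reset.inj hr
      exact .inr (.inl ⟨hv, rfl⟩)
    · exact .inl (key F (Red.reset .hole v hv) hr hF)

theorem Tm.IsValue.not_red {v u : Tm} (hv : v.IsValue) (h : Red v u) : False := by
  obtain ⟨b, rfl⟩ := hv
  exact h.lam_inv

theorem Tm.IsValue.eq_of_reds {v u : Tm} (hv : v.IsValue) (h : Reds v u) : v = u := by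
  rcases Relation.ReflTransGen.cases_head h with h | ⟨w, h, -⟩
  · exact h
  · exact (hv.not_red h).elim

theorem ECtx.IsPure.plug_shift_not_red {F : ECtx} {t u : Tm} (hF : F.IsPure)
    (h : Red (F.plug (Tm.shift t)) u) : False := by
  induction F generalizing u with
  | hole => exact h.shift_inv
  | vapp b F ih =>
    rcases h.app_inv with ⟨_, h, -⟩ | ⟨_, _, -, h, -⟩ | ⟨_, -, h, -⟩
    · exact h.lam_inv
    · exact ih hF h
    · exact plug_shift_not_isValue h
  | appl F s ih =>
    rcases h.app_inv with ⟨_, h, -⟩ | ⟨b, _, h, -⟩ | ⟨b, h, -⟩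
    · exact ih hF h
    · exact plug_shift_not_isValue ⟨b, h⟩
    · exact plug_shift_not_isValue ⟨b, h⟩
  | reset F => exact hF

/-- The inversion cases exclude each other because values and terms `E[Sk.t]` with `E` pure are
irreducible; two captures agree by `plug_shift_inj`. -/
theorem Red.deterministic {t u w : Tm} (hu : Red t u) (hw : Red t w) : u = w := by
  induction t generalizing u w with
  | var n => exact hu.var_inv.elim
  | lam t => exact hu.lam_inv.elim
  | shift t => exact hu.shift_inv.elim
  | app t s iht ihs =>
    rcases hu.app_inv with ⟨t', h, rfl⟩ | ⟨b, s', rfl, h, rfl⟩ | ⟨b, rfl, h, rfl⟩ <;>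
    rcases hw.app_inv with ⟨t'', k, rfl⟩ | ⟨c, s'', hc, k, rfl⟩ | ⟨c, hc, k, rfl⟩
    · rw [iht h k]
    · exact (Tm.IsValue.not_red ⟨c, hc⟩ h).elim
    · exact (Tm.IsValue.not_red ⟨c, hc⟩ h).elim
    · exact k.lam_inv.elim
    · rw [ihs h k, Tm.lam.inj hc]
    · exact (k.not_red h).elim
    · exact k.lam_inv.elim
    · exact (h.not_red k).elim
    · rw [Tm.lam.inj hc]
  | reset t ih =>
    rcases hu.reset_inv with ⟨t', h, rfl⟩ | ⟨h, rfl⟩ | ⟨E, b, hE, rfl, rfl⟩ <;>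
    rcases hw.reset_inv with ⟨t'', k, rfl⟩ | ⟨k, rfl⟩ | ⟨D, c, hD, k, rfl⟩
    · rw [ih h k]
    · exact (k.not_red h).elim
    · subst k
      exact (hD.plug_shift_not_red h).elim
    · exact (h.not_red k).elim
    · rfl
    · subst k
      exact (ECtx.plug_shift_not_isValue h).elim
    · exact (hE.plug_shift_not_red k).elim
    · exact (ECtx.plug_shift_not_isValue k).elim
    · obtain ⟨rfl, rfl⟩ := hE.plug_shift_inj hD k
      rfl

/-- Closedness rules out a variable in evaluation position. The point is the shape that it gives to
closed stuck terms. -/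
theorem Tm.Closed.red_or_isValue_or_shift {t : Tm} (ht : t.Closed) :
    (∃ u, Red t u) ∨ t.IsValue ∨ ∃ (E : ECtx) (b : Tm), E.IsPure ∧ t = E.plug (Tm.shift b) := by
  induction t with
  | var n => exact absurd ht (Nat.not_lt_zero n)
  | lam t => exact .inr (.inl ⟨t, rfl⟩)
  | shift t => exact .inr (.inr ⟨.hole, t, trivial, rfl⟩)
  | app t s iht ihs =>
    rcases iht ht.1 with ⟨u, h⟩ | ⟨b, rfl⟩ | ⟨E, b, hE, rfl⟩
    · exact .inl ⟨_, h.plug (.appl .hole s)⟩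
    · rcases ihs ht.2 with ⟨u, h⟩ | h | ⟨E, c, hE, rfl⟩
      · exact .inl ⟨_, h.plug (.vapp b .hole)⟩
      · exact .inl ⟨_, Red.beta .hole b s h⟩
      · exact .inr (.inr ⟨.vapp b E, c, hE, rfl⟩)
    · exact .inr (.inr ⟨.appl E s, b, hE, rfl⟩)
  | reset t ih =>
    rcases ih ht with ⟨u, h⟩ | h | ⟨E, b, hE, rfl⟩
    · exact .inl ⟨_, h.plug (.reset .hole)⟩
    · exact .inl ⟨_, Red.reset .hole t h⟩
    · exact .inl ⟨_, Red.shift .hole E b hE⟩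

theorem Stuck.exists_shift {t : Tm} (h : Stuck t) (ht : t.Closed) :
    ∃ (E : ECtx) (b : Tm), E.IsPure ∧ t = E.plug (Tm.shift b) := by
  rcases ht.red_or_isValue_or_shift with ⟨u, hu⟩ | hv | hs
  · exact (h.2 u hu).elim
  · exact (h.1 hv).elim
  · exact hs

theorem Tm.Closed.red {t u : Tm} (ht : t.Closed) (h : Red t u) : u.Closed := by
  cases h with
  | beta F t v hv =>
    rw [ECtx.plug_closed] at ht ⊢
    exact ⟨ht.1, ClosedAt.inst ht.2.1 ht.2.2⟩
  | shift F E t hE =>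
    rw [ECtx.plug_closed] at ht ⊢
    have h2 : (E.plug (Tm.shift t)).Closed := ht.2
    rw [ECtx.plug_closed] at h2
    exact ⟨ht.1, ClosedAt.inst (t := t) h2.2 h2.1.lift_plug⟩
  | reset F v hv =>
    rw [ECtx.plug_closed] at ht ⊢
    exact ht

theorem Tm.Closed.reds {t u : Tm} (ht : t.Closed) (h : Reds t u) : u.Closed := by
  induction h with
  | refl => exact ht
  | tail _ h ih => exact ih.red h

/-! ### Closures of relations -/

/-- All pairs of `r` consist of closed terms. -/
def ClosedPairs (r : Set (Tm × Tm)) : Prop := ∀ t₀ t₁, (t₀, t₁) ∈ r → t₀.Closed ∧ t₁.Closed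

/-- The relation `r` is included in the term-generating closure of `r'`. -/
def Generates (r' r : Set (Tm × Tm)) : Prop := ∀ t₀ t₁, (t₀, t₁) ∈ r → TmCl r' t₀ t₁

theorem IsEnv.closedPairs {r : Set (Tm × Tm)} (h : IsEnv r) : ClosedPairs r :=
  fun t₀ t₁ ht => ⟨(h t₀ t₁ ht).1, (h t₀ t₁ ht).2.1⟩

theorem TmCl.of_generates {r r' : Set (Tm × Tm)} (h : Generates r' r) {t t' : Tm}
    (ht : TmCl r t t') : TmCl r' t t' := by
  induction ht with
  | base ht => exact h _ _ ht
  | var n => exact .var n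
  | lam _ ih => exact .lam ih
  | app _ _ ih ih' => exact .app ih ih'
  | shift _ ih => exact .shift ih
  | reset _ ih => exact .reset ih

theorem CtxCl.of_generates {r r' : Set (Tm × Tm)} (h : Generates r' r) {F F' : ECtx}
    (hF : CtxCl r F F') : CtxCl r' F F' := by
  induction hF with
  | hole => exact .hole
  | vapp _ hv ih => exact .vapp ih (hv.of_generates h)
  | appl _ ht ih => exact .appl ih (ht.of_generates h)
  | reset _ ih => exact .reset ih

theorem Generates.refl (r : Set (Tm × Tm)) : Generates r r := fun _ _ => .base

theorem Generates.of_subset {r r' : Set (Tm × Tm)} (h : r ⊆ r') : Generates r' r :=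
  fun _ _ ht => .base (h ht)

theorem Generates.trans {r r' r'' : Set (Tm × Tm)} (h : Generates r'' r') (h' : Generates r' r) :
    Generates r'' r := fun t₀ t₁ ht => (h' t₀ t₁ ht).of_generates h

theorem TmCl.rename {r : Set (Tm × Tm)} (hr : ClosedPairs r) {t t' : Tm} (h : TmCl r t t')
    (ρ : ℕ → ℕ) : TmCl r (t.rename ρ) (t'.rename ρ) := by
  induction h generalizing ρ with
  | base h =>
    rw [(hr _ _ h).1.rename_eq, (hr _ _ h).2.rename_eq]
    exact .base h
  | var n => exact .var _
  | lam _ ih => exact .lam (ih _)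
  | app _ _ ih ih' => exact .app (ih _) (ih' _)
  | shift _ ih => exact .shift (ih _)
  | reset _ ih => exact .reset (ih _)

theorem TmCl.upSub {r : Set (Tm × Tm)} (hr : ClosedPairs r) {σ σ' : ℕ → Tm}
    (hσ : ∀ n, TmCl r (σ n) (σ' n)) : ∀ n, TmCl r (Tm.upSub σ n) (Tm.upSub σ' n)
  | 0 => .var 0
  | n + 1 => (hσ n).rename hr _

/-- Pairs of `r` are closed, hence fixed by substitution, and so remain in `r`. -/
theorem TmCl.subst {r : Set (Tm × Tm)} (hr : ClosedPairs r) {t t' : Tm} (h : TmCl r t t')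
    {σ σ' : ℕ → Tm} (hσ : ∀ n, TmCl r (σ n) (σ' n)) : TmCl r (t.subst σ) (t'.subst σ') := by
  induction h generalizing σ σ' with
  | base h =>
    rw [(hr _ _ h).1.subst_eq, (hr _ _ h).2.subst_eq]
    exact .base h
  | var n => exact hσ n
  | lam _ ih => exact .lam (ih (upSub hr hσ))
  | app _ _ ih ih' => exact .app (ih hσ) (ih' hσ)
  | shift _ ih => exact .shift (ih (upSub hr hσ))
  | reset _ ih => exact .reset (ih hσ)

theorem TmCl.inst {r : Set (Tm × Tm)} (hr : ClosedPairs r) {t t' v v' : Tm} (h : TmCl r t t')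
    (hv : TmCl r v v') : TmCl r (t.inst v) (t'.inst v') :=
  h.subst hr fun
    | 0 => hv
    | n + 1 => .var n

theorem CtxCl.lift {r : Set (Tm × Tm)} (hr : ClosedPairs r) {F F' : ECtx} (h : CtxCl r F F') :
    CtxCl r F.lift F'.lift := by
  induction h with
  | hole => exact .hole
  | vapp _ hv ih => exact .vapp ih (hv.rename hr _)
  | appl _ ht ih => exact .appl ih (ht.rename hr _)
  | reset _ ih => exact .reset ih

theorem CtxCl.plug {r : Set (Tm × Tm)} {F F' : ECtx} {t t' : Tm} (h : CtxCl r F F')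
    (ht : TmCl r t t') : TmCl r (F.plug t) (F'.plug t') := by
  induction h with
  | hole => exact ht
  | vapp _ hv ih => exact .app hv ih
  | appl _ hs ih => exact .app ih hs
  | reset _ ih => exact .reset ih

theorem CtxCl.comp {r : Set (Tm × Tm)} {F F' G G' : ECtx} (h : CtxCl r F F')
    (hG : CtxCl r G G') : CtxCl r (F.comp G) (F'.comp G') := by
  induction h with
  | hole => exact hG
  | vapp _ hv ih => exact .vapp ih hv
  | appl _ hs ih => exact .appl ih hs
  | reset _ ih => exact .reset ih

theorem CtxCl.isPure {r : Set (Tm × Tm)} {F F' : ECtx} (h : CtxCl r F F') (hF : F.IsPure) :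
    F'.IsPure := by
  induction h with
  | hole => trivial
  | vapp _ _ ih => exact ih hF
  | appl _ _ ih => exact ih hF
  | reset => exact hF

theorem TmCl.capture {r : Set (Tm × Tm)} (hr : ClosedPairs r) {E E' : ECtx} {t t' : Tm}
    (hE : CtxCl r E E') (ht : TmCl r t t') : TmCl r (capture E t) (capture E' t') :=
  .reset (ht.inst hr (.lam (.reset ((hE.lift hr).plug (.var 0)))))

theorem IsEnv.isValue_right {r : Set (Tm × Tm)} (hr : IsEnv r) {v t : Tm} (h : TmCl r v t)
    (hv : v.IsValue) : t.IsValue := by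
  obtain ⟨b, rfl⟩ := hv
  cases h with
  | base h =>
    rcases (hr _ _ h).2.2 with h | h
    · exact h.2
    · exact (h.1.1 ⟨b, rfl⟩).elim
  | lam h => exact ⟨_, rfl⟩

/-- Follow the derivation of the closure along the path to the hole of `E`. Either it reaches the
shift through constructors, or it stops at a pair of `r`. The left term of that pair is no value, so
the pair is stuck and its right term also has a shift in a pure context; `C` and `C'` need not be
related. -/
theorem IsEnv.tmCl_plug_shift {r : Set (Tm × Tm)} (hr : IsEnv r) {E : ECtx} {b u : Tm}
    (hE : E.IsPure) (h : TmCl r (E.plug (Tm.shift b)) u) :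
    (∃ (E' : ECtx) (b' : Tm), u = E'.plug (Tm.shift b') ∧ CtxCl r E E' ∧ TmCl r b b') ∨
    (∃ (D D' C C' : ECtx) (b' : Tm), E = D.comp C ∧ C'.IsPure ∧ u = D'.plug (C'.plug (Tm.shift b')) ∧
      CtxCl r D D' ∧ (C.plug (Tm.shift b), C'.plug (Tm.shift b')) ∈ r) := by
  have hbase {E : ECtx} {u : Tm} (h : (E.plug (Tm.shift b), u) ∈ r) :
      ∃ (D D' C C' : ECtx) (b' : Tm), E = D.comp C ∧ C'.IsPure ∧ u = D'.plug (C'.plug (Tm.shift b')) ∧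
        CtxCl r D D' ∧ (C.plug (Tm.shift b), C'.plug (Tm.shift b')) ∈ r := by
    obtain ⟨-, hu, ⟨hv, -⟩ | ⟨-, hs⟩⟩ := hr _ _ h
    · exact (ECtx.plug_shift_not_isValue hv).elim
    · obtain ⟨C', b', hC', rfl⟩ := hs.exists_shift hu
      exact ⟨.hole, .hole, E, C', b', rfl, hC', rfl, .hole, h⟩
  induction E generalizing u with
  | hole =>
    cases h with
    | base h => exact .inr (hbase (E := .hole) h)
    | shift h => exact .inl ⟨.hole, _, rfl, .hole, h⟩
  | vapp c E ih =>
    cases h with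
    | base h => exact .inr (hbase (E := .vapp c E) h)
    | app hc h =>
      obtain ⟨c', rfl⟩ := hr.isValue_right hc ⟨c, rfl⟩
      rcases ih hE h with ⟨E', b', rfl, h1, h2⟩ | ⟨D, D', C, C', b', rfl, h1, rfl, h2, h3⟩
      · exact .inl ⟨.vapp c' E', b', rfl, .vapp h1 hc, h2⟩
      · exact .inr ⟨.vapp c D, .vapp c' D', C, C', b', rfl, h1, rfl, .vapp h2 hc, h3⟩
  | appl E s ih =>
    cases h with
    | base h => exact .inr (hbase (E := .appl E s) h)
    | app h hs =>
      rcases ih hE h with ⟨E', b', rfl, h1, h2⟩ | ⟨D, D', C, C', b', rfl, h1, rfl, h2, h3⟩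
      · exact .inl ⟨.appl E' _, b', rfl, .appl h1 hs, h2⟩
      · exact .inr ⟨.appl D s, .appl D' _, C, C', b', rfl, h1, rfl, .appl h2 hs, h3⟩
  | reset E => exact hE.elim

/-! ### Closing a bisimulation under contexts -/

/-- Terms built from related terms in related evaluation contexts, or from a related environment,
where the relation `V` is generated by the environment at hand. -/
inductive Matched (R : Rel) (V : Set (Tm × Tm)) : Tm → Tm → Prop
  | triple {E : Set (Tm × Tm)} {F₀ F₁ : ECtx} {t₀ t₁ : Tm} (h : (E, t₀, t₁) ∈ R.triples)
      (hV : Generates E V) (hF : CtxCl E F₀ F₁) : Matched R V (F₀.plug t₀) (F₁.plug t₁)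
  | env {E : Set (Tm × Tm)} {t₀ t₁ : Tm} (h : E ∈ R.envs) (hV : Generates E V)
      (ht : TmCl E t₀ t₁) : Matched R V t₀ t₁

theorem Matched.of_generates {R : Rel} {V W : Set (Tm × Tm)} {t₀ t₁ : Tm} (h : Matched R W t₀ t₁)
    (hW : Generates W V) : Matched R V t₀ t₁ := by
  cases h with
  | triple h hV hF => exact .triple h (hV.trans hW) hF
  | env h hV ht => exact .env h (hV.trans hW) ht

theorem Matched.plug {R : Rel} {V : Set (Tm × Tm)} {t₀ t₁ : Tm} (h : Matched R V t₀ t₁)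
    {F₀ F₁ : ECtx} (hF : CtxCl V F₀ F₁) : Matched R V (F₀.plug t₀) (F₁.plug t₁) := by
  cases h with
  | triple h hV hG =>
    rw [← ECtx.comp_plug, ← ECtx.comp_plug]
    exact .triple h hV ((hF.of_generates hV).comp hG)
  | env h hV ht => exact .env h hV ((hF.of_generates hV).plug ht)

/-! ### Simulation of the left-hand side by the right-hand side -/

namespace IsEnvBisim

variable {R : Rel}

/-- Abstractions related by the closure either form a pair of `E`, where `env_val` yields a triple,
or have related bodies, where substitution stays in the closure. -/
theorem matched_inst (hR : IsEnvBisim R) {E : Set (Tm × Tm)} (hE : E ∈ R.envs) {b₀ b₁ v₀ v₁ : Tm}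
    (hb : TmCl E (Tm.lam b₀) (Tm.lam b₁)) (hv : ValCl E v₀ v₁) :
    Matched R E (b₀.inst v₀) (b₁.inst v₁) := by
  cases hb with
  | base hb => exact .triple (hR.env_val E hE _ _ hb _ _ hv) (.refl E) .hole
  | lam hb => exact .env hE (.refl E) (hb.inst (hR.env_wf E hE).closedPairs hv.1)

theorem red_of_tmCl (hR : IsEnvBisim R) {E : Set (Tm × Tm)} (hE : E ∈ R.envs) {t₀ t₁ u₀ : Tm}
    (h : TmCl E t₀ t₁) (h₀ : t₀.Closed) (h₁ : t₁.Closed) (hu : Red t₀ u₀) :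
    ∃ u₁, Reds t₁ u₁ ∧ Matched R E u₀ u₁ := by
  have wf := hR.env_wf E hE
  induction h generalizing u₀ with
  | base h =>
    rcases (wf _ _ h).2.2 with h | h
    · exact (h.1.not_red hu).elim
    · exact (h.1.2 _ hu).elim
  | var n => exact hu.var_inv.elim
  | lam => exact hu.lam_inv.elim
  | shift => exact hu.shift_inv.elim
  | app ht hs iht ihs =>
    rcases hu.app_inv with ⟨t', h, rfl⟩ | ⟨b, s', rfl, h, rfl⟩ | ⟨b, rfl, h, rfl⟩
    · obtain ⟨w, hw, hm⟩ := iht h₀.1 h₁.1 h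
      exact ⟨_, hw.plug (.appl .hole _), hm.plug (.appl .hole hs)⟩
    · obtain ⟨c, rfl⟩ := wf.isValue_right ht ⟨b, rfl⟩
      obtain ⟨w, hw, hm⟩ := ihs h₀.2 h₁.2 h
      exact ⟨_, hw.plug (.vapp c .hole), hm.plug (.vapp .hole ht)⟩
    · obtain ⟨c, rfl⟩ := wf.isValue_right ht ⟨b, rfl⟩
      have hv := wf.isValue_right hs h
      exact ⟨_, .single (.beta .hole c _ hv), hR.matched_inst hE ht ⟨hs, h, hv, h₀.2, h₁.2⟩⟩
  | reset ht ih =>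
    rcases hu.reset_inv with ⟨t', h, rfl⟩ | ⟨h, rfl⟩ | ⟨C, b, hC, rfl, rfl⟩
    · obtain ⟨w, hw, hm⟩ := ih h₀ h₁ h
      exact ⟨_, hw.plug (.reset .hole), hm.plug (.reset .hole)⟩
    · exact ⟨_, .single (.reset .hole _ (wf.isValue_right ht h)), .env hE (.refl E) ht⟩
    · rcases wf.tmCl_plug_shift hC ht with
        ⟨C', b', rfl, h1, h2⟩ | ⟨D, D', C, C', b', rfl, hC', rfl, h2, h3⟩
      · exact ⟨_, .single (.shift .hole C' b' (h1.isPure hC)),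
          .env hE (.refl E) (.capture wf.closedPairs h1 h2)⟩
      -- The captured context is `D[C]`: `D` and `D'` are related by the closure and play the role
      -- of the testing contexts in `env_stuck`, while `C` and `C'` belong to the stuck pair.
      · rw [ECtx.comp_isPure] at hC
        have hD' := h2.isPure hC.1
        have c₀ : ((D.comp C).plug (Tm.shift b)).Closed := h₀
        have c₁ : (D'.plug (C'.plug (Tm.shift b'))).Closed := h₁
        rw [ECtx.comp_plug, ECtx.plug_closed] at c₀
        rw [ECtx.plug_closed] at c₁
        have hred := Red.shift .hole (D'.comp C') b' (ECtx.comp_isPure.2 ⟨hD', hC'⟩)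
        have hm := hR.env_stuck E hE C C' b b' hC.2 hC' h3 D D' ⟨h2, hC.1, hD', c₀.1, c₁.1⟩
        rw [ECtx.comp_plug, ECtx.comp_lift, ECtx.comp_plug] at hred
        refine ⟨_, .single hred, ?_⟩
        rw [capture, ECtx.comp_lift, ECtx.comp_plug]
        exact .triple hm (.refl E) .hole

theorem red_of_matched (hR : IsEnvBisim R) {V : Set (Tm × Tm)} {t₀ t₁ u₀ : Tm}
    (h : Matched R V t₀ t₁) (h₀ : t₀.Closed) (h₁ : t₁.Closed) (hu : Red t₀ u₀) :
    ∃ u₁, Reds t₁ u₁ ∧ Matched R V u₀ u₁ := by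
  cases h with
  | env h hV ht =>
    obtain ⟨u₁, hu₁, hm⟩ := hR.red_of_tmCl h ht h₀ h₁ hu
    exact ⟨u₁, hu₁, hm.of_generates hV⟩
  | @triple E F₀ F₁ t₀ t₁ h hV hF =>
    -- Once the normal forms form a pair of the environment, `F₀[t₀]` and `F₁[s₁]` are related by
    -- its closure, and `red_of_tmCl` applies.
    have normal {s₁ : Tm} (hs : Reds t₁ s₁) (hE : E ∪ {(t₀, s₁)} ∈ R.envs) :
        ∃ u₁, Reds (F₁.plug t₁) u₁ ∧ Matched R V u₀ u₁ := by
      have hsub : Generates (E ∪ {(t₀, s₁)}) E := .of_subset Set.subset_union_left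
      have hs' := hs.plug F₁
      have ht : TmCl (E ∪ {(t₀, s₁)}) (F₀.plug t₀) (F₁.plug s₁) :=
        (hF.of_generates hsub).plug (.base (.inr rfl))
      obtain ⟨u₁, hu₁, hm⟩ := hR.red_of_tmCl hE ht h₀ (h₁.reds hs') hu
      exact ⟨u₁, hs'.trans hu₁, hm.of_generates (hsub.trans hV)⟩
    by_cases hr : ∃ t₀', Red t₀ t₀'
    · obtain ⟨t₀', ht₀⟩ := hr
      obtain ⟨t₁', ht₁, hm⟩ := hR.red_left E t₀ t₁ h t₀' ht₀
      obtain rfl := hu.deterministic (ht₀.plug F₀)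
      exact ⟨_, ht₁.plug F₁, .triple hm hV hF⟩
    · by_cases hv : t₀.IsValue
      · obtain ⟨v₁, hv₁, -, hE⟩ := hR.val_left E t₀ t₁ h hv
        exact normal hv₁ hE
      · obtain ⟨s₁, hs₁, -, hE⟩ := hR.stuck_left E t₀ t₁ h ⟨hv, fun u hu => hr ⟨u, hu⟩⟩
        exact normal hs₁ hE

theorem isValue_of_matched (hR : IsEnvBisim R) {V : Set (Tm × Tm)} {v₀ t₁ : Tm}
    (h : Matched R V v₀ t₁) (hv : v₀.IsValue) :
    ∃ v₁, Reds t₁ v₁ ∧ v₁.IsValue ∧ ∃ E ∈ R.envs, Generates E V ∧ TmCl E v₀ v₁ := by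
  cases h with
  | env h hV ht => exact ⟨t₁, .refl, (hR.env_wf _ h).isValue_right ht hv, _, h, hV, ht⟩
  | @triple E F₀ F₁ t₀ t₁ h hV hF =>
    obtain ⟨b, hb⟩ := hv
    cases hF with
    | hole =>
      obtain ⟨v₁, h1, h2, h3⟩ := hR.val_left E t₀ t₁ h ⟨b, hb⟩
      exact ⟨v₁, h1, h2, _, h3, .trans (.of_subset Set.subset_union_left) hV, .base (.inr rfl)⟩
    | _ => simp [ECtx.plug] at hb

end IsEnvBisim

/-! ### The bisimulation for programs -/

/-- The relation that an environmental bisimulation generates for the original semantics: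
the closure of matched terms under reduction and expansion. -/
def programRel (R : Rel) : Rel where
  envs := {V | IsValEnv V ∧ ∃ E ∈ R.envs, Generates E V}
  triples := {p | IsValEnv p.1 ∧ p.2.1.Closed ∧ p.2.2.Closed ∧
    ∃ r₀ r₁, Reds p.2.1 r₀ ∧ Reds p.2.2 r₁ ∧ Matched R p.1 r₀ r₁}

/-- The right-hand term does not move: the steps that answer on the right are absorbed into its
reduction to `r₁`. If the left-hand term has not yet reached `r₀`, determinism makes the given step
the first one towards it. -/
theorem red_mem_programRel {R : Rel} (hR : IsEnvBisim R) {V : Set (Tm × Tm)} {t₀ t₁ u₀ : Tm}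
    (h : (V, t₀, t₁) ∈ (programRel R).triples) (hu : Red t₀ u₀) :
    (V, u₀, t₁) ∈ (programRel R).triples := by
  obtain ⟨hV, h₀, h₁, r₀, r₁, hr₀, hr₁, hm⟩ := h
  refine ⟨hV, h₀.red hu, h₁, ?_⟩
  rcases Relation.ReflTransGen.cases_head hr₀ with rfl | ⟨w, hw, hr₀⟩
  · obtain ⟨u₁, hu₁, hm'⟩ := hR.red_of_matched hm h₀ (h₁.reds hr₁) hu
    exact ⟨u₀, u₁, .refl, hr₁.trans hu₁, hm'⟩
  · obtain rfl := hu.deterministic hw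
    exact ⟨r₀, r₁, hr₀, hr₁, hm⟩

/-- The new pair of values is only known to lie in the closure of an environment of `R`; hence
`programRel` asks for generation instead of inclusion. -/
theorem isValue_mem_programRel {R : Rel} (hR : IsEnvBisim R) {V : Set (Tm × Tm)} {v₀ t₁ : Tm}
    (h : (V, v₀, t₁) ∈ (programRel R).triples) (hv : v₀.IsValue) :
    ∃ v₁, Reds t₁ v₁ ∧ v₁.IsValue ∧ {(v₀, v₁)} ∪ V ∈ (programRel R).envs := by
  obtain ⟨hV, h₀, h₁, r₀, r₁, hr₀, hr₁, hm⟩ := h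
  obtain rfl := hv.eq_of_reds hr₀
  obtain ⟨v₁, hv₁, hv₁', E, hE, hg, ht⟩ := hR.isValue_of_matched hm hv
  have hred := hr₁.trans hv₁
  refine ⟨v₁, hred, hv₁', ?_, E, hE, ?_⟩
  · rintro a b (hab | hab)
    · obtain ⟨rfl, rfl⟩ := Prod.mk.inj hab
      exact ⟨h₀, h₁.reds hred, hv, hv₁'⟩
    · exact hV a b hab
  · rintro a b (hab | hab)
    · obtain ⟨rfl, rfl⟩ := Prod.mk.inj hab
      exact ht
    · exact hg a b hab

/-! ### Exchanging the two sides -/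

/-- The converse relation. -/
def converse (r : Set (Tm × Tm)) : Set (Tm × Tm) := {p | (p.2, p.1) ∈ r}

theorem converse_union_singleton (r : Set (Tm × Tm)) (t s : Tm) :
    converse r ∪ {(t, s)} = converse (r ∪ {(s, t)}) := by
  ext ⟨a, b⟩
  simp [converse, and_comm]

theorem converse_singleton_union (r : Set (Tm × Tm)) (t s : Tm) :
    {(t, s)} ∪ converse r = converse ({(s, t)} ∪ r) := by
  ext ⟨a, b⟩
  simp [converse, and_comm]

theorem TmCl.converse {r : Set (Tm × Tm)} {t s : Tm} (h : TmCl r t s) :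
    TmCl (converse r) s t := by
  induction h with
  | base h => exact .base h
  | var n => exact .var n
  | lam _ ih => exact .lam ih
  | app _ _ ih ih' => exact .app ih ih'
  | shift _ ih => exact .shift ih
  | reset _ ih => exact .reset ih

theorem CtxCl.converse {r : Set (Tm × Tm)} {F G : ECtx} (h : CtxCl r F G) :
    CtxCl (converse r) G F := by
  induction h with
  | hole => exact .hole
  | vapp _ hv ih => exact .vapp ih hv.converse
  | appl _ ht ih => exact .appl ih ht.converse
  | reset _ ih => exact .reset ih

theorem IsEnv.converse {r : Set (Tm × Tm)} (h : IsEnv r) : IsEnv (converse r) := fun t s hts =>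
  let ⟨h1, h2, h3⟩ := h s t hts
  ⟨h2, h1, h3.imp And.symm And.symm⟩

theorem IsValEnv.converse {r : Set (Tm × Tm)} (h : IsValEnv r) : IsValEnv (converse r) :=
  fun t s hts =>
    let ⟨h1, h2, h3, h4⟩ := h s t hts
    ⟨h2, h1, h4, h3⟩

/-- The environmental relation with the two sides exchanged. -/
def Rel.swap (R : Rel) : Rel where
  envs := {E | converse E ∈ R.envs}
  triples := {p | (converse p.1, p.2.2, p.2.1) ∈ R.triples}

theorem IsEnvBisim.swap {R : Rel} (hR : IsEnvBisim R) : IsEnvBisim R.swap where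
  env_wf := fun _ h => (hR.env_wf _ h).converse
  triple_wf := fun _ _ _ h =>
    let ⟨h1, h2, h3⟩ := hR.triple_wf _ _ _ h
    ⟨h1.converse, h3, h2⟩
  red_left := fun _ _ _ h => hR.red_right _ _ _ h
  red_right := fun _ _ _ h => hR.red_left _ _ _ h
  val_left := fun _ _ _ h hv =>
    let ⟨v, h1, h2, h3⟩ := hR.val_right _ _ _ h hv
    ⟨v, h1, h2, (converse_union_singleton _ _ _ ▸ h3 :)⟩
  val_right := fun _ _ _ h hv =>
    let ⟨v, h1, h2, h3⟩ := hR.val_left _ _ _ h hv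
    ⟨v, h1, h2, (converse_union_singleton _ _ _ ▸ h3 :)⟩
  stuck_left := fun _ _ _ h hv =>
    let ⟨v, h1, h2, h3⟩ := hR.stuck_right _ _ _ h hv
    ⟨v, h1, h2, (converse_union_singleton _ _ _ ▸ h3 :)⟩
  stuck_right := fun _ _ _ h hv =>
    let ⟨v, h1, h2, h3⟩ := hR.stuck_left _ _ _ h hv
    ⟨v, h1, h2, (converse_union_singleton _ _ _ ▸ h3 :)⟩
  env_val := fun _ hE t₀ t₁ ht _ _ ⟨h1, h2, h3, h4, h5⟩ =>
    hR.env_val _ hE t₁ t₀ ht _ _ ⟨h1.converse, h3, h2, h5, h4⟩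
  env_stuck := fun _ hE _ _ _ _ h₀ h₁ ht _ _ ⟨h1, h2, h3, h4, h5⟩ =>
    hR.env_stuck _ hE _ _ _ _ h₁ h₀ ht _ _ ⟨h1.converse, h3, h2, h5, h4⟩

theorem Generates.converse {r r' : Set (Tm × Tm)} (h : Generates r' r) :
    Generates (converse r') (converse r) := fun _ _ ht => (h _ _ ht).converse

theorem Matched.swap {R : Rel} {V : Set (Tm × Tm)} {t₀ t₁ : Tm} (h : Matched R V t₀ t₁) :
    Matched R.swap (converse V) t₁ t₀ := by
  cases h with
  | triple h hV hF => exact .triple (R := R.swap) (E := converse _) h hV.converse hF.converse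
  | env h hV ht => exact .env (R := R.swap) (E := converse _) h hV.converse ht.converse

/-- Reduces the clauses on the right for `R` to those on the left for `R.swap`. -/
theorem programRel_swap_triples {R : Rel} {V : Set (Tm × Tm)} {t₀ t₁ : Tm} :
    (converse V, t₁, t₀) ∈ (programRel R.swap).triples ↔ (V, t₀, t₁) ∈ (programRel R).triples :=
  ⟨fun ⟨h1, h2, h3, r₀, r₁, h4, h5, h6⟩ => ⟨h1.converse, h3, h2, r₁, r₀, h5, h4, h6.swap⟩,
    fun ⟨h1, h2, h3, r₀, r₁, h4, h5, h6⟩ => ⟨h1.converse, h3, h2, r₁, r₀, h5, h4, h6.swap⟩⟩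

theorem mem_programRel_envs_of_swap {R : Rel} {V : Set (Tm × Tm)}
    (h : converse V ∈ (programRel R.swap).envs) : V ∈ (programRel R).envs :=
  let ⟨h1, E, hE, hg⟩ := h
  ⟨h1.converse, converse E, hE, hg.converse⟩

/-! ### The bisimulation property for programs and the conclusion -/

theorem IsEnvBisim.programRel {R : Rel} (hR : IsEnvBisim R) : IsEnvBisimP (programRel R) where
  env_wf := fun _ h => h.1
  triple_wf := fun _ _ _ h => ⟨h.1, h.2.1, h.2.2.1⟩
  ctx := by
    rintro V t₀ t₁ ⟨hV, h₀, h₁, r₀, r₁, hr₀, hr₁, hm⟩ - C₀ C₁ ⟨hC, -, -, hC₀, hC₁⟩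
    exact ⟨hV, ECtx.plug_closed.2 ⟨hC₀, h₀⟩, ECtx.plug_closed.2 ⟨hC₁, h₁⟩, _, _,
      hr₀.plug C₀.reset, hr₁.plug C₁.reset, hm.plug hC.reset⟩
  -- Answering with `p₁` itself keeps the right-hand side a program; the term supplied by
  -- `red_of_matched` could already be a value.
  red_left := fun _ _ p₁ h _ h₁ _ hr _ => ⟨p₁, .refl, h₁, red_mem_programRel hR h hr⟩
  red_right := fun _ p₀ _ h h₀ _ _ hr _ => ⟨p₀, .refl, h₀,
    programRel_swap_triples.1 (red_mem_programRel hR.swap (programRel_swap_triples.2 h) hr)⟩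
  val_left := fun _ _ _ h _ _ _ hr hv =>
    isValue_mem_programRel hR (red_mem_programRel hR h hr) hv
  val_right := fun _ _ _ h _ _ _ hr hv =>
    let ⟨v, h1, h2, h3⟩ := isValue_mem_programRel hR.swap
      (red_mem_programRel hR.swap (programRel_swap_triples.2 h) hr) hv
    ⟨v, h1, h2, mem_programRel_envs_of_swap (converse_singleton_union _ _ _ ▸ h3)⟩
  env_val := by
    rintro V ⟨hV, E, hE, hg⟩ t₀ t₁ ht v₀ v₁ ⟨hv, hv₀, hv₁, c₀, c₁⟩
    obtain ⟨d₀, d₁, -, -⟩ := hV _ _ ht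
    exact ⟨hV, Tm.ClosedAt.inst (t := t₀) d₀ c₀, Tm.ClosedAt.inst (t := t₁) d₁ c₁, _, _,
      .refl, .refl, (hR.matched_inst hE (hg _ _ ht)
        ⟨hv.of_generates hg, hv₀, hv₁, c₀, c₁⟩).of_generates hg⟩

theorem IsEnvBisim.empBisimP {R : Rel} (hR : IsEnvBisim R) {t₀ t₁ : Tm}
    (h : (∅, t₀, t₁) ∈ R.triples) : EmpBisimP t₀ t₁ := by
  obtain ⟨-, h₀, h₁⟩ := hR.triple_wf _ _ _ h
  exact ⟨_, hR.programRel, fun _ _ h => h.elim, h₀, h₁, t₀, t₁, .refl, .refl,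
    .triple h (.refl ∅) .hole⟩

end ShiftReset

theorem lemmal :
    (∀ t₀ t₁ : ShiftReset.Tm, ShiftReset.EmpBisim t₀ t₁ → ShiftReset.EmpBisimP t₀ t₁) ∧
    (∀ R : ShiftReset.Rel, ShiftReset.IsEnvBisim R →
      ∀ t₀ t₁ : ShiftReset.Tm, (∅, t₀, t₁) ∈ R.triples → ShiftReset.EmpBisimP t₀ t₁) :=
  ⟨fun _ _ ⟨_, hR, h⟩ => hR.empBisimP h, fun _ hR _ _ h => hR.empBisimP h⟩
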